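/- Let $\mathcal S$ be a connected closed triangular mesh of genus zero in $\mathbb R^3$ with nondegenerate triangles and vertices $v_1,\dots,v_n$, and let $L_D\in\mathbb R^{n\times n}$ be its cotangent Laplacian: $[L_D]_{ij}=w_{ij}=-\tfrac12(\cot\alpha_{ij}+\cot\alpha_{ji})$ if $[v_i,v_j]$ is an edge, where $\alpha_{ij},\alpha_{ji}$ are the two angles opposite to this edge; $[L_D]_{ii}=-\sum_{\ell\ne i}w_{i\ell}$; and $[L_D]_{ij}=0$ otherwise. Let $f_1,\dots,f_n\in\mathbb S^2$ be the images of the vertices under an initial spherical map, let $h^{(1)}_i\in\mathbb C\cup\{\infty\}$ be the image of $f_i$ under stereographic projection from the north pole, and let $\rho_0>1$ be a radius. For an index set $\mathtt I$ let its boundary be the set of all $j\notin\mathtt I$ such that $[v_i,v_j]$ is an edge for some $i\in\mathtt I$. Put $\mathtt I_1=\{i: |h^{(1)}_i|<\rho_0\}$ and let $\mathtt B_1$ be its boundary; assume $h^{(1)}_j\neq\infty$ for $j\in\mathtt B_1$. Let $h_i=h_i^{(1)}$ for $i\notin\mathtt I_1$, let $h_{\mathtt I_1}=-L_1^{-1}B_1h^{(1)}_{\mathtt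 B_1}$, and let $h^{(2)}_i=|h_i|^{-2}h_i$ (with $0$ and $\infty$ exchanged). Put $\mathtt I_2=\{i:|h^{(2)}_i|<\rho_0\}$ and let $\mathtt B_2$ be its boundary. Here, for $s=1,2$, $L_s=[L_D]_{\mathtt I_s,\mathtt I_s}$ and $B_s=[L_D]_{\mathtt I_s,\mathtt B_s}$. Write $m_s=\#\mathtt B_s$, $P_1=[I_n]_{\mathtt B_2,\mathtt I_1}$, $P_2=[I_n]_{\mathtt B_1,\mathtt I_2}$, and $$A_s=-P_sL_s^{-1}B_s\quad(s=1,2),\qquad A_1\in\mathbb R^{m_2\times m_1},\ A_2\in\mathbb R^{m_1\times m_2}.$$ Let $[\mathbf q_1^\top,\mathbf q_2^\top]^\top$ with $\mathbf q_1\in\mathbb R^{m_2}$, $\mathbf q_2\in\mathbb R^{m_1}$ and $\mathbf q_2^\top\mathbf 1_{m_1}=1$ be a left eigenvector of $\mathcal A=\begin{bmatrix}0&A_1\\A_2&0\end{bmatrix}$ for the eigenvalue $1$. Then $$\sigma\big((A_2-\mathbf 1_{m_1}\mathbf q_1^\top)A_1\big)=\sigma\big(A_2A_1-\mathbf 1_{m_1}\mathbf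 q_2^\top\big)=(\sigma(A_2A_1)\setminus\{1\})\cup\{0\}$$ and $$\rho\big((A_2-\mathbf 1_{m_1}\mathbf q_1^\top)A_1\big)=\rho\big(A_2A_1-\mathbf 1_{m_1}\mathbf q_2^\top\big)<1,$$ where $\sigma$ denotes the set of complex eigenvalues and $\rho$ the spectral radius. -/

import Mathlib

open scoped OnePoint

noncomputable section

/-- The graph of edges of the triangles in `F`. -/
def trianglesGraph {V : Type*} (F : Finset (Finset V)) : SimpleGraph V where
  Adj i j := i ≠ j ∧ ∃ t ∈ F, i ∈ t ∧ j ∈ t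
  symm := ⟨fun _ _ h => ⟨h.1.symm, h.2.imp fun _ ht => ⟨ht.1, ht.2.2, ht.2.1⟩⟩⟩
  loopless := ⟨fun _ h => h.1 rfl⟩

/-- The link of the vertex `v`: its vertices are the neighbours of `v`, its edges are the sides
opposite to `v` of the triangles that contain `v`. -/
def linkGraph {V : Type*} (F : Finset (Finset V)) (v : V) :
    SimpleGraph {w : V // (trianglesGraph F).Adj v w} where
  Adj a b := a ≠ b ∧ ∃ t ∈ F, v ∈ t ∧ (a : V) ∈ t ∧ (b : V) ∈ t
  symm := ⟨fun _ _ h => ⟨h.1.symm, h.2.imp fun _ ht => ⟨ht.1, ht.2.1, ht.2.2.2, ht.2.2.1⟩⟩⟩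
  loopless := ⟨fun _ h => h.1 rfl⟩

/-- A connected closed triangular mesh in `ℝ³` with vertex set `V`: a finite pure two-dimensional
simplicial complex whose underlying space is a connected closed surface, together with vertex
positions for which no triangle is degenerate. -/
structure ClosedTriMesh (V : Type*) where
  /-- Positions of the vertices. -/
  pos : V → EuclideanSpace ℝ (Fin 3)
  /-- The triangles, as sets of three vertices. -/
  faces : Finset (Finset V)
  card_face : ∀ t ∈ faces, t.card = 3
  nondegenerate : ∀ t ∈ faces, AffineIndependent ℝ (fun i : {x // x ∈ t} => pos i)
  /-- Every edge lies in exactly two triangles. -/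
  edge_two_faces : ∀ i j : V, (trianglesGraph faces).Adj i j →
    {t | t ∈ faces ∧ i ∈ t ∧ j ∈ t}.ncard = 2
  /-- The link of every vertex is connected and nonempty (hence a cycle). -/
  link_connected : ∀ v : V, (linkGraph faces v).Connected
  /-- Any two vertices are joined by a path of edges. -/
  connected : (trianglesGraph faces).Connected

/-- Stereographic projection of the unit sphere from the north pole onto `ℂ ∪ {∞}`. -/
def stereoProj (p : Metric.sphere (0 : EuclideanSpace ℝ (Fin 3)) 1) : OnePoint ℂ :=
  open Classical in
  if p.1 2 = 1 then ∞ else ((⟨p.1 0 / (1 - p.1 2), p.1 1 / (1 - p.1 2)⟩ : ℂ) : OnePoint ℂ)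

/-- The inversion `z ↦ |z|⁻² z` of `ℂ ∪ {∞}`, exchanging `0` and `∞`. -/
def sphereInversion : OnePoint ℂ → OnePoint ℂ
  | OnePoint.infty => ((0 : ℂ) : OnePoint ℂ)
  | OnePoint.some z =>
    open Classical in if z = 0 then ∞ else (((‖z‖ ^ 2)⁻¹ • z : ℂ) : OnePoint ℂ)

/-- The finite value of a point of `ℂ ∪ {∞}`, with the convention `0` at `∞`. -/
def finiteValue : OnePoint ℂ → ℂ
  | OnePoint.infty => 0
  | OnePoint.some z => z

/-- The indices `i` with `|h i| < r`; the value `∞` never qualifies. -/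
def innerIdx {V : Type*} [Fintype V] (r : ℝ) (h : V → OnePoint ℂ) : Finset V :=
  open Classical in
  Finset.univ.filter fun i => ∃ z : ℂ, h i = (z : OnePoint ℂ) ∧ ‖z‖ < r

namespace ClosedTriMesh

variable {V : Type*} (M : ClosedTriMesh V)

/-- The edges `[v_i, v_j]` of the mesh. -/
def edgeGraph : SimpleGraph V := trianglesGraph M.faces

/-- Genus zero: the Euler characteristic is two. -/
def IsGenusZero : Prop :=
  (Nat.card V : ℤ) - M.edgeGraph.edgeSet.ncard + M.faces.card = 2

variable [Fintype V] [DecidableEq V]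

/-- The cotangent weight `-(cot α_ij + cot α_ji) / 2`: the sum runs over the (two) triangles
`{i, j, k}` that contain the edge, and the angle is the one at `k`. It is `0` if `i ≠ j` are not
adjacent. -/
def cotWeight (i j : V) : ℝ :=
  -(1 / 2) * ∑ t ∈ M.faces.filter (fun t => i ∈ t ∧ j ∈ t), ∑ k ∈ t \ {i, j},
    Real.cot (EuclideanGeometry.angle (M.pos i) (M.pos k) (M.pos j))

/-- The discrete Laplacian `L_D`. -/
def laplacian : Matrix V V ℝ :=
  Matrix.of fun i j => if i = j then -∑ l ∈ Finset.univ.erase i, M.cotWeight i l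
    else M.cotWeight i j

/-- The vertices outside `I` that are joined by an edge to a vertex of `I`. -/
def bdry (I : Finset V) : Finset V :=
  open Classical in
  Finset.univ.filter fun j => j ∉ I ∧ ∃ i ∈ I, M.edgeGraph.Adj i j

/-- The block `[L_D]_{I,I}`. -/
def innerBlock (I : Finset V) : Matrix {i // i ∈ I} {i // i ∈ I} ℝ :=
  M.laplacian.submatrix (fun i => i.1) (fun i => i.1)

/-- The block `[L_D]_{I,B}`, where `B` is the boundary of `I`. -/
def bdryBlock (I : Finset V) : Matrix {i // i ∈ I} {j // j ∈ M.bdry I} ℝ :=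
  M.laplacian.submatrix (fun i => i.1) (fun j => j.1)

/-- The block `[I_n]_{B,I}` of the identity matrix, where `B` is the boundary of `J`. -/
def selBlock (I J : Finset V) : Matrix {j // j ∈ M.bdry J} {i // i ∈ I} ℝ :=
  (1 : Matrix V V ℝ).submatrix (fun j => j.1) (fun i => i.1)

/-- The matrix `-P L⁻¹ B` that maps boundary values of `I` to the values, at the boundary of `J`,
of the solution of the Laplace equation in `I`. -/
def transferMatrix (I J : Finset V) : Matrix {j // j ∈ M.bdry J} {j // j ∈ M.bdry I} ℝ :=
  -(M.selBlock I J * (M.innerBlock I)⁻¹ * M.bdryBlock I)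

/-- Replace the values of `h` in `I` by the solution `-L⁻¹ B h_B` of the discrete Laplace equation
with the values of `h` on the boundary `B` of `I`. (A value `∞` on `B` has no meaning here; it is
excluded wherever this is used.) -/
def harmonicUpdate (I : Finset V) (h : V → OnePoint ℂ) : V → OnePoint ℂ := fun i =>
  if hi : i ∈ I then
    (((-((M.innerBlock I)⁻¹ * M.bdryBlock I)).map (fun x : ℝ => (x : ℂ))).mulVec
      (fun j => finiteValue (h j.1)) ⟨i, hi⟩ : ℂ)
  else h i

variable (r : ℝ) (f : V → Metric.sphere (0 : EuclideanSpace ℝ (Fin 3)) 1)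

/-- The southern index set `I_1` of the spherical map `f` and the radius `r`. -/
def southIdx : Finset V := innerIdx r fun i => stereoProj (f i)

/-- The northern index set `I_2`: solve the Laplace equation on `I_1`, then invert. -/
def northIdx : Finset V :=
  innerIdx r fun i =>
    sphereInversion (M.harmonicUpdate (southIdx r f) (fun i => stereoProj (f i)) i)

/-- The index set `B_1`, with `m_1` elements. -/
abbrev southBdry : Finset V := M.bdry (southIdx r f)

/-- The index set `B_2`, with `m_2` elements. -/
abbrev northBdry : Finset V := M.bdry (M.northIdx r f)

/-- The matrix `A_1`, of size `m_2 × m_1`. -/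
def A₁ : Matrix {j // j ∈ M.northBdry r f} {j // j ∈ M.southBdry r f} ℝ :=
  M.transferMatrix (southIdx r f) (M.northIdx r f)

/-- The matrix `A_2`, of size `m_1 × m_2`. -/
def A₂ : Matrix {j // j ∈ M.southBdry r f} {j // j ∈ M.northBdry r f} ℝ :=
  M.transferMatrix (M.northIdx r f) (southIdx r f)

/-- The block matrix with zero diagonal blocks and off-diagonal blocks `A_1`, `A_2`. -/
def blockA : Matrix ({j // j ∈ M.northBdry r f} ⊕ {j // j ∈ M.southBdry r f})
    ({j // j ∈ M.northBdry r f} ⊕ {j // j ∈ M.southBdry r f}) ℝ :=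
  Matrix.fromBlocks 0 (M.A₁ r f) (M.A₂ r f) 0

end ClosedTriMesh

/-- The set of complex eigenvalues of a real square matrix. -/
def matSpectrum {m : Type*} [Fintype m] [DecidableEq m] (A : Matrix m m ℝ) : Set ℂ :=
  spectrum ℂ (A.map (fun x : ℝ => (x : ℂ)))

/-- The spectral radius of a real square matrix: the largest modulus of a complex eigenvalue. -/
def matSpectralRadius {m : Type*} [Fintype m] [DecidableEq m] (A : Matrix m m ℝ) : ENNReal :=
  spectralRadius ℂ (A.map (fun x : ℝ => (x : ℂ)))

end

/-!
In a triangle the cotangents of the angles satisfy `ab + bc + ca = 1` and have positive pairwise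
sums, so the cotangent Dirichlet form of a nondegenerate triangle is positive definite modulo
constants. Summing over the faces of a connected mesh, the Laplacian is positive semidefinite and
its kernel consists of the constants. In particular constants are harmonic, which gives
`A₁ 1 = 1` and `A₂ 1 = 1`.

Applying `A₂ A₁` is one cycle of the alternating Schwarz method: solve the Dirichlet problem in
`I₁`, then in `I₂`. Each harmonic replacement lowers the Dirichlet energy by the energy of the
correction, whereas a cycle started from an eigenvector for `c` multiplies the energy by `|c|²`.
If `|c| ≥ 1`, both corrections therefore have energy zero, the function is harmonic everywhere, and
hence it is constant. So `1` is the only eigenvalue of modulus at least one and its eigenvectors are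
the constants. Deflating with the right eigenvector `1` and the left eigenvector `q₂` moves this
eigenvalue to `0` and keeps all the others.
-/

section LinearAlgebra

open Matrix

variable {m n V K : Type*} [Fintype m]

theorem mulVec_extend_zero [Fintype V] [NonUnitalNonAssocSemiring K] {e : m → V}
    (he : e.Injective) (A : Matrix n V K) (z : m → K) :
    A *ᵥ Function.extend e z 0 = A.submatrix id e *ᵥ z := by
  ext i
  refine (Fintype.sum_of_injective e he _ _ (fun j hj => ?_) fun k => ?_).symm
  · rw [Function.extend_apply' _ _ _ hj, Pi.zero_apply, mul_zero]
  · simp only [submatrix_apply, id, he.extend_apply]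

theorem map_nonsing_inv [DecidableEq m] {F : Type*} [Field K] [Field F] (φ : K →+* F)
    (A : Matrix m m K) : A⁻¹.map φ = (A.map φ)⁻¹ := by
  have hdet : (A.map φ).det = φ A.det := (φ.map_det A).symm
  have hadj : (A.map φ).adjugate = A.adjugate.map φ := (φ.map_adjugate A).symm
  ext i j
  simp [Matrix.inv_def, Ring.inverse_eq_inv', hdet, hadj]

theorem dotProduct_eq_zero_of_eigenvalue_ne [Field K] {T : Matrix m m K} {q x : m → K} {μ c : K}
    (hq : q ᵥ* T = μ • q) (hx : T *ᵥ x = c • x) (hc : c ≠ μ) : q ⬝ᵥ x = 0 := by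
  have h : c * (q ⬝ᵥ x) = μ * (q ⬝ᵥ x) := by
    simpa only [hx, hq, dotProduct_smul, smul_dotProduct, smul_eq_mul]
      using dotProduct_mulVec q T x
  by_contra h0
  exact hc (mul_right_cancel₀ h0 h)

variable [DecidableEq m]

theorem mem_spectrum_iff_exists_mulVec_eq_smul [Field K] (A : Matrix m m K) (c : K) :
    c ∈ spectrum K A ↔ ∃ x : m → K, x ≠ 0 ∧ A *ᵥ x = c • x := by
  rw [← spectrum_toLin', ← Module.End.hasEigenvalue_iff_mem_spectrum]
  refine ⟨fun h => ?_, fun ⟨x, hx, h⟩ => ?_⟩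
  · obtain ⟨x, hx⟩ := h.exists_hasEigenvector
    exact ⟨x, hx.2, hx.apply_eq_smul⟩
  · exact Module.End.hasEigenvalue_of_hasEigenvector
      ⟨Module.End.mem_eigenspace_iff.2 h, hx⟩

/-- Wielandt deflation: eigenvectors for eigenvalues other than `μ` are orthogonal to the left
eigenvector `q`, so the rank-one correction does not see them. -/
theorem spectrum_sub_smul_vecMulVec [Field K] {T : Matrix m m K} {v q : m → K} {μ : K}
    (hv : T *ᵥ v = μ • v) (hq : q ᵥ* T = μ • q) (hqv : q ⬝ᵥ v = 1)
    (hsimple : ∀ x, T *ᵥ x = μ • x → ∃ d : K, x = d • v) :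
    spectrum K (T - μ • vecMulVec v q) = (spectrum K T \ {μ}) ∪ {0} := by
  have hdefl (x : m → K) :
      (T - μ • vecMulVec v q) *ᵥ x = T *ᵥ x - (μ * (q ⬝ᵥ x)) • v := by
    rw [sub_mulVec, smul_mulVec, vecMulVec_mulVec, op_smul_eq_smul, smul_smul]
  have hannih : q ᵥ* (T - μ • vecMulVec v q) = (0 : K) • q := by
    rw [vecMul_sub, vecMul_smul, vecMul_vecMulVec, hq, hqv, one_smul, sub_self, zero_smul]
  ext c
  simp only [Set.mem_union, Set.mem_sdiff, Set.mem_singleton_iff,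
    mem_spectrum_iff_exists_mulVec_eq_smul]
  constructor
  · rintro ⟨x, hx, hcx⟩
    refine or_iff_not_imp_right.2 fun hc => ?_
    have hqx : q ⬝ᵥ x = 0 := dotProduct_eq_zero_of_eigenvalue_ne hannih hcx hc
    rw [hdefl, hqx, mul_zero, zero_smul, sub_zero] at hcx
    refine ⟨⟨x, hx, hcx⟩, ?_⟩
    rintro rfl
    obtain ⟨d, rfl⟩ := hsimple x hcx
    rw [dotProduct_smul, hqv, smul_eq_mul, mul_one] at hqx
    exact hx (by rw [hqx, zero_smul])
  · rintro (⟨⟨x, hx, hcx⟩, hc⟩ | rfl)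
    · have hqx : q ⬝ᵥ x = 0 := dotProduct_eq_zero_of_eigenvalue_ne hq hcx hc
      exact ⟨x, hx, by rw [hdefl, hqx, mul_zero, zero_smul, sub_zero, hcx]⟩
    · refine ⟨v, ?_, by rw [hdefl, hv, hqv, mul_one, sub_self, zero_smul]⟩
      rintro rfl
      simp at hqv

open scoped NNReal in
theorem spectralRadius_lt_of_forall_norm_lt (A : Matrix m m ℂ) {r : ℝ≥0} (hr : 0 < r)
    (h : ∀ c ∈ spectrum ℂ A, ‖c‖₊ < r) : spectralRadius ℂ A < r := by
  cases isEmpty_or_nonempty m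
  · simpa [Subsingleton.elim A 0] using hr
  let _ := Matrix.linftyOpNormedRing (n := m) (α := ℂ)
  let _ := Matrix.linftyOpNormedAlgebra (R := ℂ) (n := m) (α := ℂ)
  exact spectrum.spectralRadius_lt_of_forall_lt A h

end LinearAlgebra

section Energy

open Matrix
open scoped ComplexOrder

/-- The vector `v` solves the discrete Dirichlet problem for `L` in `I`: it keeps the values of `u`
outside `I` and is harmonic in `I`. -/
structure IsHarmonicReplacement {V K : Type*} [Fintype V] [NonUnitalNonAssocSemiring K]
    (L : Matrix V V K) (I : Finset V) (u v : V → K) : Prop where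
  eq_of_notMem : ∀ i ∉ I, v i = u i
  mulVec_eq_zero : ∀ i ∈ I, (L *ᵥ v) i = 0

section DirichletProblem

variable {V K : Type*} [Fintype V]

theorem mulVec_apply_eq_add_of_support [NonUnitalNonAssocSemiring K]
    {L : Matrix V V K} {I B : Finset V} (hIB : Disjoint I B)
    (hL : ∀ i ∈ I, ∀ j ∉ I, j ∉ B → L i j = 0) (u : V → K) (i : I) :
    (L *ᵥ u) i = (L.submatrix (fun i : I => i.1) (fun j : I => j.1) *ᵥ fun j => u j) i
      + (L.submatrix (fun i : I => i.1) (fun j : B => j.1) *ᵥ fun j => u j) i := by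
  classical
  simp only [mulVec, dotProduct, submatrix_apply]
  rw [Finset.sum_coe_sort I (fun j => L i j * u j), Finset.sum_coe_sort B (fun j => L i j * u j),
    ← Finset.sum_union hIB]
  refine (Finset.sum_subset (Finset.subset_univ _) fun j _ hj => ?_).symm
  rw [Finset.mem_union, not_or] at hj
  rw [hL i i.2 j hj.1 hj.2, zero_mul]

variable [DecidableEq V] [Field K] {L : Matrix V V K} {I : Finset V}

theorem exists_isHarmonicReplacement
    (hunit : IsUnit (L.submatrix (fun i : I => i.1) (fun i : I => i.1))) (u : V → K) :
    ∃ v, IsHarmonicReplacement L I u v := by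
  set LI := L.submatrix (fun i : I => i.1) (fun i : I => i.1)
  have hdet := (isUnit_iff_isUnit_det _).1 hunit
  set z : I → K := LI⁻¹ *ᵥ fun i : I => -(L *ᵥ u) i.1 with hz
  refine ⟨u + Function.extend (fun i : I => i.1) z 0, fun i hi => ?_, fun i hi => ?_⟩
  · have hrange : ¬ ∃ k : I, k.1 = i := fun ⟨k, hk⟩ => hi (hk ▸ k.2)
    rw [Pi.add_apply, Function.extend_apply' _ _ _ hrange, Pi.zero_apply, add_zero]
  · have hcorrection : LI *ᵥ z = fun i : I => -(L *ᵥ u) i.1 := by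
      rw [hz, mulVec_mulVec, mul_nonsing_inv _ hdet, one_mulVec]
    rw [mulVec_add, mulVec_extend_zero Subtype.val_injective, Pi.add_apply]
    exact add_eq_zero_iff_neg_eq.2 (congrFun hcorrection ⟨i, hi⟩).symm

theorem restrict_eq_of_mulVec_eq_zero
    (hunit : IsUnit (L.submatrix (fun i : I => i.1) (fun i : I => i.1))) {B : Finset V}
    (hIB : Disjoint I B)
    (hL : ∀ i ∈ I, ∀ j ∉ I, j ∉ B → L i j = 0) {v : V → K} (hv : ∀ i ∈ I, (L *ᵥ v) i = 0) :
    (fun i : I => v i) = -((L.submatrix (fun i : I => i.1) (fun i : I => i.1))⁻¹ *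
      L.submatrix (fun i : I => i.1) (fun j : B => j.1)) *ᵥ (fun j : B => v j) := by
  set LI := L.submatrix (fun i : I => i.1) (fun i : I => i.1)
  set LB := L.submatrix (fun i : I => i.1) (fun j : B => j.1)
  have hblock : LI *ᵥ (fun i : I => v i) = -(LB *ᵥ fun j : B => v j) := by
    ext i
    exact eq_neg_of_add_eq_zero_left
      ((mulVec_apply_eq_add_of_support hIB hL v i).symm.trans (hv i i.2))
  have hdet := (isUnit_iff_isUnit_det _).1 hunit
  rw [neg_mulVec, ← mulVec_mulVec, ← mulVec_neg, ← hblock, mulVec_mulVec,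
    nonsing_inv_mul _ hdet, one_mulVec]

end DirichletProblem

section DirichletEnergy

variable {V 𝕜 : Type*} [Fintype V] [RCLike 𝕜] {L : Matrix V V 𝕜}

/-- The Dirichlet energy of `u` with respect to `L`. For Hermitian `L` the form is real; the real
part only serves to make it real-valued. -/
def dirichletEnergy (L : Matrix V V 𝕜) (u : V → 𝕜) : ℝ := RCLike.re (star u ⬝ᵥ (L *ᵥ u))

theorem dirichletEnergy_smul (c : 𝕜) (u : V → 𝕜) :
    dirichletEnergy L (c • u) = ‖c‖ ^ 2 * dirichletEnergy L u := by
  rw [dirichletEnergy, star_smul, mulVec_smul, smul_dotProduct, dotProduct_smul, smul_smul,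
    RCLike.star_def, RCLike.conj_mul, ← RCLike.ofReal_pow, smul_eq_mul, RCLike.re_ofReal_mul,
    dirichletEnergy]

theorem dirichletEnergy_nonneg (hL : L.PosSemidef) (u : V → 𝕜) : 0 ≤ dirichletEnergy L u :=
  hL.re_dotProduct_nonneg u

theorem dirichletEnergy_eq_zero_iff (hL : L.PosSemidef) {u : V → 𝕜} :
    dirichletEnergy L u = 0 ↔ L *ᵥ u = 0 := by
  have him := (RCLike.nonneg_iff.1 (hL.dotProduct_mulVec_nonneg u)).2
  rw [← hL.dotProduct_mulVec_zero_iff]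
  exact ⟨fun hre => RCLike.ext (hre.trans (map_zero _).symm) (him.trans (map_zero _).symm),
    fun h => by rw [dirichletEnergy, h, map_zero]⟩

theorem IsHarmonicReplacement.dirichletEnergy_eq_add (hL : L.IsHermitian) {I : Finset V}
    {u v : V → 𝕜} (h : IsHarmonicReplacement L I u v) :
    dirichletEnergy L u = dirichletEnergy L v + dirichletEnergy L (u - v) := by
  have hright : star (u - v) ⬝ᵥ (L *ᵥ v) = 0 := by
    refine Finset.sum_eq_zero fun i _ => ?_
    by_cases hi : i ∈ I
    · rw [h.mulVec_eq_zero i hi, mul_zero]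
    · simp [h.eq_of_notMem i hi]
  have hleft : star v ⬝ᵥ (L *ᵥ (u - v)) = 0 := by
    rw [dotProduct_mulVec, ← hL.eq, ← star_mulVec, star_dotProduct, hright, star_zero]
  have hsplit : u = v + (u - v) := (add_sub_cancel v u).symm
  unfold dirichletEnergy
  conv_lhs => rw [hsplit, star_add, mulVec_add, add_dotProduct, dotProduct_add, dotProduct_add,
    hright, hleft, add_zero, zero_add, map_add]

theorem mulVec_eq_zero_of_schwarz_cycle [DecidableEq V] (hL : L.PosSemidef) {I J : Finset V}
    (hIJ : I ∪ J = Finset.univ) {c : 𝕜} (hc : 1 ≤ ‖c‖) {u v : V → 𝕜}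
    (huv : IsHarmonicReplacement L I u v) (hvu : IsHarmonicReplacement L J v (c • u)) :
    L *ᵥ u = 0 := by
  have hI := huv.dirichletEnergy_eq_add hL.isHermitian
  have hJ := hvu.dirichletEnergy_eq_add hL.isHermitian
  rw [dirichletEnergy_smul] at hJ
  have hgrow : dirichletEnergy L u ≤ ‖c‖ ^ 2 * dirichletEnergy L u :=
    le_mul_of_one_le_left (dirichletEnergy_nonneg hL u) (one_le_pow₀ hc)
  have hI0 := dirichletEnergy_nonneg hL (u - v)
  have hJ0 := dirichletEnergy_nonneg hL (v - c • u)
  have hLu : L *ᵥ u = L *ᵥ v := by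
    rw [← sub_eq_zero, ← mulVec_sub, ← dirichletEnergy_eq_zero_iff hL]
    linarith
  have hLv : L *ᵥ v = L *ᵥ (c • u) := by
    rw [← sub_eq_zero, ← mulVec_sub, ← dirichletEnergy_eq_zero_iff hL]
    linarith
  ext i
  rcases Finset.mem_union.1 (hIJ ▸ Finset.mem_univ i) with hi | hi
  · rw [hLu, huv.mulVec_eq_zero i hi, Pi.zero_apply]
  · rw [hLu, hLv, hvu.mulVec_eq_zero i hi, Pi.zero_apply]

theorem isUnit_submatrix_of_mulVec_ker_const {m : Type*} [Fintype m] [DecidableEq m]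
    (hL : L.PosSemidef) (hker : ∀ u, L *ᵥ u = 0 → ∀ i j, u i = u j) {e : m → V}
    (he : e.Injective) (hsurj : ¬ e.Surjective) : IsUnit (L.submatrix e e) := by
  rw [isUnit_iff_isUnit_det, isUnit_iff_ne_zero, Ne, ← exists_mulVec_eq_zero_iff]
  rintro ⟨z, hz0, hz⟩
  set u := Function.extend e z 0 with hu
  have hLu : L *ᵥ u = 0 := by
    rw [← hL.dotProduct_mulVec_zero_iff]
    refine Finset.sum_eq_zero fun i _ => ?_
    by_cases hi : ∃ k, e k = i
    · obtain ⟨k, rfl⟩ := hi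
      have : (L *ᵥ u) (e k) = 0 := by
        rw [mulVec_extend_zero he]
        exact congrFun hz k
      rw [this, mul_zero]
    · simp [hu, Function.extend_apply' _ _ _ hi]
  obtain ⟨b, hb⟩ := not_forall.1 hsurj
  refine hz0 (funext fun k => ?_)
  rw [← he.extend_apply z 0 k, ← hu, hker u hLu (e k) b, hu, Function.extend_apply' _ _ _ hb,
    Pi.zero_apply, Pi.zero_apply]

end DirichletEnergy

open scoped MatrixOrder in
theorem posSemidef_map_ofReal {V 𝕜 : Type*} [Finite V] [RCLike 𝕜] {L : Matrix V V ℝ}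
    (hL : L.PosSemidef) : (L.map (RCLike.ofReal : ℝ → 𝕜)).PosSemidef := by
  classical
  cases nonempty_fintype V
  obtain ⟨B, rfl⟩ := CStarAlgebra.nonneg_iff_eq_star_mul_self.1 hL.nonneg
  have hfactor : (star B * B).map (RCLike.ofReal : ℝ → 𝕜)
      = (B.map RCLike.ofReal)ᴴ * B.map RCLike.ofReal := by
    ext i j
    simp [Matrix.mul_apply]
  rw [hfactor]
  exact posSemidef_conjTranspose_mul_self _

end Energy

section Cotangents

open Real

theorem cot_add_cot {α β : ℝ} (hα : sin α ≠ 0) (hβ : sin β ≠ 0) :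
    cot α + cot β = sin (α + β) / (sin α * sin β) := by
  rw [cot_eq_cos_div_sin, cot_eq_cos_div_sin, div_add_div _ _ hα hβ, sin_add,
    add_comm (sin α * cos β)]

theorem cot_add_cot_pos {α β : ℝ} (hα : 0 < α) (hβ : 0 < β) (hαβ : α + β < π) :
    0 < cot α + cot β := by
  have hsinα := sin_pos_of_pos_of_lt_pi hα (by linarith)
  have hsinβ := sin_pos_of_pos_of_lt_pi hβ (by linarith)
  have hsin_add := sin_pos_of_pos_of_lt_pi (add_pos hα hβ) hαβ
  rw [cot_add_cot hsinα.ne' hsinβ.ne']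
  positivity

theorem cot_mul_cot_add_cot_mul_add_cot_eq_one {α β γ : ℝ} (hα : sin α ≠ 0) (hβ : sin β ≠ 0)
    (hγ : sin γ ≠ 0) (hsum : α + β + γ = π) :
    cot α * cot γ + cot β * (cot α + cot γ) = 1 := by
  obtain rfl : β = π - (α + γ) := by linarith
  rw [cot_add_cot hα hγ, cot_eq_cos_div_sin (π - _), cos_pi_sub, cos_add, sin_pi_sub,
    cot_eq_cos_div_sin, cot_eq_cos_div_sin]
  rw [sin_pi_sub] at hβ
  field_simp
  ring

/-- The Dirichlet form of a triangle with angles `α`, `β`, `γ`, evaluated on a function whose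
differences along the sides opposite to these angles are `x`, `y` and `x + y`. -/
noncomputable def cotForm (α β γ x y : ℝ) : ℝ :=
  cot α * x ^ 2 + cot β * y ^ 2 + cot γ * (x + y) ^ 2

variable {α β γ : ℝ}

theorem add_mul_cotForm (hα : 0 < α) (hβ : 0 < β) (hγ : 0 < γ) (hsum : α + β + γ = π) (x y : ℝ) :
    (cot α + cot γ) * cotForm α β γ x y
      = ((cot α + cot γ) * x + cot γ * y) ^ 2 + y ^ 2 := by
  have hsin {θ : ℝ} (hθ : 0 < θ) (hθπ : θ < π) : sin θ ≠ 0 := (sin_pos_of_pos_of_lt_pi hθ hθπ).ne'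
  have hcot := cot_mul_cot_add_cot_mul_add_cot_eq_one (hsin hα (by linarith))
    (hsin hβ (by linarith)) (hsin hγ (by linarith)) hsum
  unfold cotForm
  linear_combination y ^ 2 * hcot

theorem cotForm_nonneg (hα : 0 < α) (hβ : 0 < β) (hγ : 0 < γ) (hsum : α + β + γ = π) (x y : ℝ) :
    0 ≤ cotForm α β γ x y := by
  refine nonneg_of_mul_nonneg_right ?_ (cot_add_cot_pos hα hγ (by linarith))
  rw [add_mul_cotForm hα hβ hγ hsum]
  positivity

theorem cotForm_eq_zero_iff (hα : 0 < α) (hβ : 0 < β) (hγ : 0 < γ) (hsum : α + β + γ = π)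
    {x y : ℝ} : cotForm α β γ x y = 0 ↔ x = 0 ∧ y = 0 := by
  refine ⟨fun h => ?_, fun ⟨hx, hy⟩ => by simp [cotForm, hx, hy]⟩
  have hpos : 0 < cot α + cot γ := cot_add_cot_pos hα hγ (by linarith)
  have hsq := add_mul_cotForm hα hβ hγ hsum x y
  rw [h, mul_zero] at hsq
  obtain ⟨hlin, hy⟩ := (add_eq_zero_iff_of_nonneg (sq_nonneg _) (sq_nonneg y)).1 hsq.symm
  rw [sq_eq_zero_iff] at hlin hy
  rw [hy, mul_zero, add_zero] at hlin
  exact ⟨(mul_eq_zero.1 hlin).resolve_left hpos.ne', hy⟩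

end Cotangents

section Sums

theorem sum_sum_sum_sdiff_pair {V R : Type*} [DecidableEq V] [NonAssocSemiring R] {a b c : V}
    (hab : a ≠ b) (hac : a ≠ c) (hbc : b ≠ c) {F : V → V → V → R}
    (hdiag : ∀ i k, F i i k = 0) (hsymm : ∀ i j k, F i j k = F j i k) :
    ∑ i ∈ {a, b, c}, ∑ j ∈ {a, b, c}, ∑ k ∈ {a, b, c} \ {i, j}, F i j k
      = 2 * (F a b c + F b c a + F c a b) := by
  have hsum (G : V → R) : ∑ i ∈ {a, b, c}, G i = G a + G b + G c := by
    rw [Finset.sum_insert (by simp [hab, hac]), Finset.sum_pair hbc, add_assoc]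
  have hsdiff_c : ({a, b, c} : Finset V) \ {a, b} = {c} := by grind
  have hsdiff_a : ({a, b, c} : Finset V) \ {b, c} = {a} := by grind
  have hsdiff_b : ({a, b, c} : Finset V) \ {c, a} = {b} := by grind
  rw [hsum, hsum, hsum, hsum, Finset.pair_comm b a, Finset.pair_comm c b, Finset.pair_comm a c,
    hsdiff_c, hsdiff_a, hsdiff_b]
  simp only [Finset.sum_singleton, hdiag, Finset.sum_const_zero, hsymm b a, hsymm c b, hsymm a c,
    two_mul]
  abel

theorem two_mul_sum_mul_sum_mul_sub {V R : Type*} [Fintype V] [CommRing R] {w : V → V → R}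
    (hw : ∀ i j, w i j = w j i) (u : V → R) :
    2 * ∑ i, u i * ∑ j, w i j * (u i - u j) = ∑ i, ∑ j, w i j * (u i - u j) ^ 2 := by
  have hswap : ∑ i, ∑ j, u i * (w i j * (u i - u j)) = ∑ i, ∑ j, u j * (w i j * (u j - u i)) := by
    rw [Finset.sum_comm]
    exact Finset.sum_congr rfl fun i _ => Finset.sum_congr rfl fun j _ => by rw [hw]
  have hexpand : ∑ i, u i * ∑ j, w i j * (u i - u j) = ∑ i, ∑ j, u i * (w i j * (u i - u j)) := by
    simp only [Finset.mul_sum]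
  rw [hexpand, two_mul]
  nth_rw 2 [hswap]
  simp only [← Finset.sum_add_distrib]
  exact Finset.sum_congr rfl fun i _ => Finset.sum_congr rfl fun j _ => by ring

end Sums

section Complexify

open Matrix

variable {l m n : Type*}

/-- The complexification of a real matrix. -/
abbrev complexify (A : Matrix m n ℝ) : Matrix m n ℂ := A.map fun x : ℝ => (x : ℂ)

theorem complexify_neg (A : Matrix m n ℝ) : complexify (-A) = -complexify A :=
  Matrix.map_neg _ Complex.ofReal_neg A

variable [Fintype m]

theorem complexify_mul (A : Matrix l m ℝ) (B : Matrix m n ℝ) :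
    complexify (A * B) = complexify A * complexify B :=
  Matrix.map_mul (f := Complex.ofRealHom)

theorem complexify_mulVec (A : Matrix l m ℝ) (x : m → ℝ) :
    complexify A *ᵥ (fun i => (x i : ℂ)) = fun i => ((A *ᵥ x) i : ℂ) :=
  funext fun i => (Complex.ofRealHom.map_mulVec A x i).symm

theorem vecMul_complexify (A : Matrix m n ℝ) (x : m → ℝ) :
    (fun i => (x i : ℂ)) ᵥ* complexify A = fun i => ((x ᵥ* A) i : ℂ) :=
  funext fun i => (Complex.ofRealHom.map_vecMul A x i).symm

variable [DecidableEq m]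

theorem complexify_nonsing_inv (A : Matrix m m ℝ) : complexify A⁻¹ = (complexify A)⁻¹ :=
  map_nonsing_inv Complex.ofRealHom A

theorem matSpectrum_sub_vecMulVec {T : Matrix m m ℝ} {v q : m → ℝ} (hv : T *ᵥ v = v)
    (hq : q ᵥ* T = q) (hqv : q ⬝ᵥ v = 1)
    (hsimple : ∀ x, complexify T *ᵥ x = x → ∃ d : ℂ, x = d • fun i => (v i : ℂ)) :
    matSpectrum (T - vecMulVec v q) = (matSpectrum T \ {1}) ∪ {0} := by
  have hmap : complexify (T - vecMulVec v q)
      = complexify T - (1 : ℂ) • vecMulVec (fun i => (v i : ℂ)) fun i => (q i : ℂ) := by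
    ext i j
    simp [vecMulVec_apply]
  have hqv' : (fun i => (q i : ℂ)) ⬝ᵥ (fun i => (v i : ℂ)) = 1 := by
    exact_mod_cast (Complex.ofRealHom.map_dotProduct q v).symm.trans (congrArg _ hqv)
  change spectrum ℂ (complexify _) = spectrum ℂ (complexify T) \ {1} ∪ {0}
  rw [hmap]
  refine spectrum_sub_smul_vecMulVec ?_ ?_ hqv' fun x hx => hsimple x (by rw [hx, one_smul])
  · rw [complexify_mulVec, hv, one_smul]
  · rw [vecMul_complexify, hq, one_smul]

theorem matSpectralRadius_lt_one {A : Matrix m m ℝ} (h : ∀ c ∈ matSpectrum A, ‖c‖ < 1) :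
    matSpectralRadius A < 1 := by
  change spectralRadius ℂ (complexify A) < 1
  exact_mod_cast spectralRadius_lt_of_forall_norm_lt (complexify A) one_pos h

end Complexify

namespace ClosedTriMesh

open Matrix
open scoped ComplexOrder

variable {V : Type*} (M : ClosedTriMesh V)

section TriangleEnergy

variable {M} {t : Finset V}

theorem not_collinear_of_mem_faces (ht : t ∈ M.faces) : ¬ Collinear ℝ (M.pos '' t) := by
  rw [collinear_iff_finrank_le_one, Set.image_eq_range,
    finrank_vectorSpan_le_iff_not_affineIndependent ℝ _ (by simp [M.card_face t ht]), not_not]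
  exact M.nondegenerate t ht

variable [DecidableEq V]

variable (M) (t) in
/-- The Dirichlet energy of `u` on the triangle `t` with cotangent weights. The sum runs over
ordered pairs `(i, j)`, so every side is counted twice. -/
noncomputable def triangleEnergy (u : V → ℝ) : ℝ :=
  ∑ i ∈ t, ∑ j ∈ t, ∑ k ∈ t \ {i, j},
    Real.cot (EuclideanGeometry.angle (M.pos i) (M.pos k) (M.pos j)) * (u i - u j) ^ 2

theorem triangleEnergy_insert_pair {a b c : V} (hab : a ≠ b) (hac : a ≠ c) (hbc : b ≠ c)
    (u : V → ℝ) :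
    M.triangleEnergy {a, b, c} u
      = 2 * cotForm (EuclideanGeometry.angle (M.pos a) (M.pos c) (M.pos b))
        (EuclideanGeometry.angle (M.pos b) (M.pos a) (M.pos c))
        (EuclideanGeometry.angle (M.pos c) (M.pos b) (M.pos a)) (u a - u b) (u b - u c) := by
  rw [triangleEnergy, sum_sum_sum_sdiff_pair hab hac hbc (by simp)
    (fun i j k => by rw [EuclideanGeometry.angle_comm, ← neg_sub, neg_sq]), cotForm,
    sub_add_sub_cancel, ← neg_sub (u a) (u c), neg_sq]

theorem exists_triangleEnergy_eq_cotForm (ht : t ∈ M.faces) :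
    ∃ a b c, t = {a, b, c} ∧ ∃ α β γ : ℝ, 0 < α ∧ 0 < β ∧ 0 < γ ∧ α + β + γ = Real.pi ∧
      ∀ u, M.triangleEnergy t u = 2 * cotForm α β γ (u a - u b) (u b - u c) := by
  have hncol := not_collinear_of_mem_faces ht
  obtain ⟨a, b, c, hab, hac, hbc, rfl⟩ := Finset.card_eq_three.1 (M.card_face t ht)
  simp only [Finset.coe_insert, Finset.coe_singleton, Set.image_insert_eq, Set.image_singleton]
    at hncol
  have hacb : ¬ Collinear ℝ {M.pos a, M.pos c, M.pos b} := by rwa [Set.pair_comm]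
  have hbac : ¬ Collinear ℝ {M.pos b, M.pos a, M.pos c} := by rwa [Set.insert_comm]
  have hcba : ¬ Collinear ℝ {M.pos c, M.pos b, M.pos a} := by
    rwa [Set.insert_comm, Set.pair_comm, Set.insert_comm]
  refine ⟨a, b, c, rfl, _, _, _, EuclideanGeometry.angle_pos_of_not_collinear hacb,
    EuclideanGeometry.angle_pos_of_not_collinear hbac,
    EuclideanGeometry.angle_pos_of_not_collinear hcba, ?_, triangleEnergy_insert_pair hab hac hbc⟩
  rw [add_right_comm]
  exact EuclideanGeometry.angle_add_angle_add_angle_eq_pi _ (ne₁₂_of_not_collinear hacb).symm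

theorem triangleEnergy_nonneg (ht : t ∈ M.faces) (u : V → ℝ) : 0 ≤ M.triangleEnergy t u := by
  obtain ⟨a, b, c, -, α, β, γ, hα, hβ, hγ, hsum, henergy⟩ := exists_triangleEnergy_eq_cotForm ht
  rw [henergy]
  exact mul_nonneg zero_le_two (cotForm_nonneg hα hβ hγ hsum _ _)

theorem eq_of_triangleEnergy_eq_zero (ht : t ∈ M.faces) {u : V → ℝ}
    (h : M.triangleEnergy t u = 0) {i j : V} (hi : i ∈ t) (hj : j ∈ t) : u i = u j := by
  obtain ⟨a, b, c, rfl, α, β, γ, hα, hβ, hγ, hsum, henergy⟩ := exists_triangleEnergy_eq_cotForm ht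
  rw [henergy, mul_eq_zero_iff_left two_ne_zero, cotForm_eq_zero_iff hα hβ hγ hsum] at h
  have hab : u a = u b := sub_eq_zero.1 h.1
  have hbc : u b = u c := sub_eq_zero.1 h.2
  grind

end TriangleEnergy

section Laplacian

variable [DecidableEq V]

theorem cotWeight_comm (i j : V) : M.cotWeight i j = M.cotWeight j i := by
  simp only [cotWeight, Finset.pair_comm i j, and_comm (a := i ∈ _),
    EuclideanGeometry.angle_comm (M.pos i)]

variable {M} in
theorem cotWeight_eq_zero_of_not_adj {i j : V} (hij : i ≠ j) (h : ¬ M.edgeGraph.Adj i j) :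
    M.cotWeight i j = 0 := by
  have hempty : M.faces.filter (fun t => i ∈ t ∧ j ∈ t) = ∅ :=
    Finset.filter_eq_empty_iff.2 fun t ht hmem => h ⟨hij, t, ht, hmem⟩
  rw [cotWeight, hempty, Finset.sum_empty, mul_zero]

variable [Fintype V]

theorem sum_sum_cotWeight_mul_sq (u : V → ℝ) :
    ∑ i, ∑ j, M.cotWeight i j * (u i - u j) ^ 2
      = -(1 / 2) * ∑ t ∈ M.faces, M.triangleEnergy t u := by
  simp only [cotWeight, triangleEnergy, mul_assoc, ← Finset.mul_sum, Finset.sum_mul,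
    Finset.sum_filter]
  rw [Finset.sum_congr rfl fun i _ => Finset.sum_comm, Finset.sum_comm]
  refine congrArg _ (Finset.sum_congr rfl fun t _ => ?_)
  rw [← Finset.sum_subset (Finset.subset_univ t) fun i _ hi => by simp [hi]]
  refine Finset.sum_congr rfl fun i hi => ?_
  rw [← Finset.sum_subset (Finset.subset_univ t) fun j _ hj => by simp [hj]]
  exact Finset.sum_congr rfl fun j hj => by
    simp [hi, hj, Finset.sum_mul]

theorem laplacian_isSymm : M.laplacian.IsSymm := by
  ext i j
  simp only [laplacian, transpose_apply, of_apply]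
  by_cases h : i = j
  · rw [h]
  · rw [if_neg h, if_neg (Ne.symm h), cotWeight_comm]

theorem laplacian_mulVec_apply (u : V → ℝ) (i : V) :
    (M.laplacian *ᵥ u) i = -∑ j, M.cotWeight i j * (u i - u j) := by
  have hoff : ∑ j ∈ Finset.univ.erase i, M.laplacian i j * u j
      = ∑ j ∈ Finset.univ.erase i, M.cotWeight i j * u j :=
    Finset.sum_congr rfl fun j hj => by
      rw [laplacian, of_apply, if_neg (Finset.ne_of_mem_erase hj).symm]
  have hdiag : M.laplacian i i = -∑ j ∈ Finset.univ.erase i, M.cotWeight i j := if_pos rfl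
  rw [mulVec, dotProduct, ← Finset.add_sum_erase _ _ (Finset.mem_univ i), hoff, hdiag,
    ← Finset.add_sum_erase (a := i) _ (fun j => M.cotWeight i j * (u i - u j)) (Finset.mem_univ i)]
  simp only [sub_self, mul_zero, zero_add, mul_sub, Finset.sum_sub_distrib, ← Finset.sum_mul]
  ring

theorem laplacian_mulVec_one : M.laplacian *ᵥ 1 = 0 := by
  ext i
  simp [laplacian_mulVec_apply]

theorem dirichletEnergy_laplacian (u : V → ℝ) :
    dirichletEnergy M.laplacian u = 1 / 4 * ∑ t ∈ M.faces, M.triangleEnergy t u := by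
  have hsymm := two_mul_sum_mul_sum_mul_sub M.cotWeight_comm u
  rw [sum_sum_cotWeight_mul_sq] at hsymm
  simp only [dirichletEnergy, star_trivial, RCLike.re_to_real, dotProduct, laplacian_mulVec_apply,
    mul_neg, Finset.sum_neg_distrib]
  linarith

theorem posSemidef_laplacian : M.laplacian.PosSemidef := by
  refine .of_dotProduct_mulVec_nonneg ?_ fun u => ?_
  · rw [IsHermitian, conjTranspose_eq_transpose_of_trivial, M.laplacian_isSymm.eq]
  · refine (M.dirichletEnergy_laplacian u).ge.trans' (mul_nonneg (by norm_num) ?_)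
    exact Finset.sum_nonneg fun t ht => triangleEnergy_nonneg ht u

variable {M} in
theorem eq_of_laplacian_mulVec_eq_zero {u : V → ℝ} (h : M.laplacian *ᵥ u = 0) (i j : V) :
    u i = u j := by
  have henergy : dirichletEnergy M.laplacian u = 0 :=
    (dirichletEnergy_eq_zero_iff M.posSemidef_laplacian).2 h
  rw [dirichletEnergy_laplacian, mul_eq_zero_iff_left (by norm_num),
    Finset.sum_eq_zero_iff_of_nonneg fun t ht => triangleEnergy_nonneg ht u] at henergy
  obtain ⟨walk⟩ := M.connected.preconnected i j
  induction walk with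
  | nil => rfl
  | cons hadj _ ih =>
    obtain ⟨-, t, ht, hi, hj⟩ := hadj
    exact (eq_of_triangleEnergy_eq_zero ht (henergy t ht) hi hj).trans ih

end Laplacian

section ComplexLaplacian

variable [Fintype V] [DecidableEq V]

variable {M} in
theorem eq_of_complexify_laplacian_mulVec_eq_zero {u : V → ℂ}
    (h : complexify M.laplacian *ᵥ u = 0) (i j : V) : u i = u j := by
  have hre : M.laplacian *ᵥ (fun i => (u i).re) = 0 := by
    ext i
    simpa [mulVec, dotProduct] using congrArg Complex.re (congrFun h i)
  have him : M.laplacian *ᵥ (fun i => (u i).im) = 0 := by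
    ext i
    simpa [mulVec, dotProduct] using congrArg Complex.im (congrFun h i)
  exact Complex.ext (eq_of_laplacian_mulVec_eq_zero hre i j)
    (eq_of_laplacian_mulVec_eq_zero him i j)

theorem posSemidef_complexify_laplacian : (complexify M.laplacian).PosSemidef :=
  posSemidef_map_ofReal M.posSemidef_laplacian

theorem complexify_laplacian_mulVec_one : complexify M.laplacian *ᵥ 1 = 0 := by
  have h := complexify_mulVec M.laplacian 1
  rw [laplacian_mulVec_one] at h
  simpa [Pi.one_def, Pi.zero_def] using h

variable {M} {I : Finset V}

theorem isUnit_submatrix_complexify_laplacian (hI : I ≠ Finset.univ) :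
    IsUnit ((complexify M.laplacian).submatrix (fun i : I => i.1) (fun i : I => i.1)) := by
  refine isUnit_submatrix_of_mulVec_ker_const M.posSemidef_complexify_laplacian
    (fun _ => eq_of_complexify_laplacian_mulVec_eq_zero) Subtype.val_injective fun hsurj => hI ?_
  refine Finset.eq_univ_of_forall fun i => ?_
  obtain ⟨k, rfl⟩ := hsurj i
  exact k.2

end ComplexLaplacian

section Transfer

variable [Fintype V] [DecidableEq V] {M} {I J : Finset V}

theorem mem_bdry {j : V} : j ∈ M.bdry I ↔ j ∉ I ∧ ∃ i ∈ I, M.edgeGraph.Adj i j := by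
  simp [bdry]

theorem disjoint_bdry : Disjoint I (M.bdry I) :=
  Finset.disjoint_right.2 fun _ hj => (mem_bdry.1 hj).1

theorem bdry_subset_of_union_eq_univ (hIJ : I ∪ J = Finset.univ) : M.bdry I ⊆ J := fun j hj =>
  (Finset.mem_union.1 (hIJ ▸ Finset.mem_univ j)).resolve_left (mem_bdry.1 hj).1

theorem ne_univ_of_bdry_fun_ne_zero {R : Type*} [Zero R] {q : M.bdry I → R} (hq : q ≠ 0) :
    I ≠ Finset.univ := by
  obtain ⟨j, -⟩ := Function.ne_iff.1 hq
  rintro rfl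
  exact (mem_bdry.1 j.2).1 (Finset.mem_univ j.1)

theorem laplacian_apply_eq_zero {i j : V} (hi : i ∈ I) (hj : j ∉ I) (hj' : j ∉ M.bdry I) :
    M.laplacian i j = 0 := by
  have hij : i ≠ j := fun h => hj (h ▸ hi)
  rw [laplacian, of_apply, if_neg hij, cotWeight_eq_zero_of_not_adj hij]
  exact fun hadj => hj' (mem_bdry.2 ⟨hj, i, hi, hadj⟩)

theorem restrict_eq_of_harmonic (hI : I ≠ Finset.univ) {v : V → ℂ}
    (hv : ∀ i ∈ I, (complexify M.laplacian *ᵥ v) i = 0) :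
    (fun i : I => v i) = complexify (-((M.innerBlock I)⁻¹ * M.bdryBlock I)) *ᵥ
      fun j : M.bdry I => v j := by
  rw [complexify_neg, complexify_mul, complexify_nonsing_inv]
  refine restrict_eq_of_mulVec_eq_zero (isUnit_submatrix_complexify_laplacian hI) disjoint_bdry
    (fun i hi j hj hj' => ?_) hv
  exact (congrArg Complex.ofReal (laplacian_apply_eq_zero hi hj hj')).trans Complex.ofReal_zero

theorem complexify_selBlock_mulVec (hJI : M.bdry J ⊆ I) (v : V → ℂ) :
    complexify (M.selBlock I J) *ᵥ (fun i : I => v i) = fun j : M.bdry J => v j := by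
  ext j
  rw [mulVec, dotProduct, Finset.sum_eq_single ⟨j, hJI j.2⟩]
  · simp [selBlock]
  · intro i _ hi
    have hji : (j : V) ≠ i := fun h => hi (Subtype.ext h.symm)
    simp [selBlock, one_apply_ne hji]
  · simp

theorem complexify_transferMatrix_mulVec (hI : I ≠ Finset.univ) (hJI : M.bdry J ⊆ I) {v : V → ℂ}
    (hv : ∀ i ∈ I, (complexify M.laplacian *ᵥ v) i = 0) :
    complexify (M.transferMatrix I J) *ᵥ (fun j : M.bdry I => v j) = fun j : M.bdry J => v j := by
  rw [transferMatrix, Matrix.mul_assoc, ← Matrix.mul_neg, complexify_mul, ← mulVec_mulVec,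
    ← restrict_eq_of_harmonic hI hv, complexify_selBlock_mulVec hJI]

theorem transferMatrix_mulVec_one (hI : I ≠ Finset.univ) (hJI : M.bdry J ⊆ I) :
    M.transferMatrix I J *ᵥ 1 = 1 := by
  have h : complexify (M.transferMatrix I J) *ᵥ (fun _ => 1) = fun _ => 1 :=
    complexify_transferMatrix_mulVec hI hJI (v := 1) fun i _ => by
      rw [complexify_laplacian_mulVec_one, Pi.zero_apply]
  have hreal := complexify_mulVec (M.transferMatrix I J) 1
  simp only [Pi.one_apply, Complex.ofReal_one, h] at hreal
  ext j
  exact_mod_cast (congrFun hreal j).symm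

end Transfer

section SchwarzCycle

variable [Fintype V] [DecidableEq V] {M} {I J : Finset V}

theorem exists_schwarz_cycle (hI : I ≠ Finset.univ) (hJ : J ≠ Finset.univ)
    (hIJ : I ∪ J = Finset.univ) {c : ℂ} (hc : c ≠ 0) {x : M.bdry I → ℂ}
    (hx : complexify (M.transferMatrix J I * M.transferMatrix I J) *ᵥ x = c • x) :
    ∃ u v, (∀ j : M.bdry I, u j = x j) ∧ IsHarmonicReplacement (complexify M.laplacian) I u v ∧
      IsHarmonicReplacement (complexify M.laplacian) J v (c • u) := by
  have hBI : M.bdry I ⊆ J := bdry_subset_of_union_eq_univ hIJ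
  have hBJ : M.bdry J ⊆ I := bdry_subset_of_union_eq_univ ((Finset.union_comm J I).trans hIJ)
  have hreplace {K : Finset V} (hK : K ≠ Finset.univ) :=
    exists_isHarmonicReplacement (isUnit_submatrix_complexify_laplacian (M := M) hK)
  obtain ⟨v₀, hv₀⟩ := hreplace hI (Function.extend Subtype.val x 0)
  obtain ⟨w, hw⟩ := hreplace hJ v₀
  have hv₀x : (fun j : M.bdry I => v₀ j) = x := funext fun j => by
    rw [hv₀.eq_of_notMem j (mem_bdry.1 j.2).1, Subtype.val_injective.extend_apply]
  have hwv₀ : (fun j : M.bdry J => w j) = fun j : M.bdry J => v₀ j :=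
    funext fun j => hw.eq_of_notMem j (mem_bdry.1 j.2).1
  have hwx : (fun j : M.bdry I => w j) = c • x := by
    rw [← complexify_transferMatrix_mulVec hJ hBI hw.mulVec_eq_zero, hwv₀,
      ← complexify_transferMatrix_mulVec hI hBJ hv₀.mulVec_eq_zero, hv₀x, mulVec_mulVec,
      ← complexify_mul, hx]
  have hux (j : M.bdry I) : (c⁻¹ • w) j = x j := by
    rw [Pi.smul_apply, congrFun hwx j, Pi.smul_apply, inv_smul_smul₀ hc]
  obtain ⟨v, hv⟩ := hreplace hI (c⁻¹ • w)
  have hvx : (fun j : M.bdry I => v j) = x := funext fun j => by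
    rw [hv.eq_of_notMem j (mem_bdry.1 j.2).1, hux]
  have hvv₀ : (fun i : I => v i) = fun i : I => v₀ i := by
    rw [restrict_eq_of_harmonic hI hv.mulVec_eq_zero, hvx,
      restrict_eq_of_harmonic hI hv₀.mulVec_eq_zero, hv₀x]
  refine ⟨c⁻¹ • w, v, hux, hv, fun i hi => ?_, ?_⟩
  · have hiI : i ∈ I := (Finset.mem_union.1 (hIJ ▸ Finset.mem_univ i)).resolve_right hi
    rw [smul_inv_smul₀ hc, hw.eq_of_notMem i hi]
    exact (congrFun hvv₀ ⟨i, hiI⟩).symm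
  · rw [smul_inv_smul₀ hc]
    exact hw.mulVec_eq_zero

theorem exists_eq_smul_one_of_one_le_norm (hI : I ≠ Finset.univ) (hJ : J ≠ Finset.univ)
    (hIJ : I ∪ J = Finset.univ) {c : ℂ} (hc : 1 ≤ ‖c‖) {x : M.bdry I → ℂ}
    (hx : complexify (M.transferMatrix J I * M.transferMatrix I J) *ᵥ x = c • x) :
    ∃ d : ℂ, x = d • 1 := by
  have hc0 : c ≠ 0 := norm_pos_iff.1 (zero_lt_one.trans_le hc)
  obtain ⟨u, v, hux, huv, hvu⟩ := exists_schwarz_cycle hI hJ hIJ hc0 hx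
  have hLu : complexify M.laplacian *ᵥ u = 0 :=
    mulVec_eq_zero_of_schwarz_cycle M.posSemidef_complexify_laplacian hIJ hc huv hvu
  obtain ⟨b⟩ := M.connected.nonempty
  refine ⟨u b, funext fun j => ?_⟩
  rw [← hux, eq_of_complexify_laplacian_mulVec_eq_zero hLu j b, Pi.smul_apply, Pi.one_apply,
    smul_eq_mul, mul_one]

theorem transferMatrix_mul_mulVec_one (hI : I ≠ Finset.univ) (hJ : J ≠ Finset.univ)
    (hIJ : I ∪ J = Finset.univ) : (M.transferMatrix J I * M.transferMatrix I J) *ᵥ 1 = 1 := by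
  rw [← mulVec_mulVec,
    transferMatrix_mulVec_one hI (bdry_subset_of_union_eq_univ ((Finset.union_comm J I).trans hIJ)),
    transferMatrix_mulVec_one hJ (bdry_subset_of_union_eq_univ hIJ)]

theorem norm_lt_one_of_mem_matSpectrum (hI : I ≠ Finset.univ) (hJ : J ≠ Finset.univ)
    (hIJ : I ∪ J = Finset.univ) {c : ℂ}
    (hc : c ∈ matSpectrum (M.transferMatrix J I * M.transferMatrix I J)) (hc1 : c ≠ 1) :
    ‖c‖ < 1 := by
  obtain ⟨x, hx0, hx⟩ := (mem_spectrum_iff_exists_mulVec_eq_smul _ c).1 hc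
  by_contra! hnorm
  obtain ⟨d, rfl⟩ := exists_eq_smul_one_of_one_le_norm hI hJ hIJ hnorm hx
  have hone := complexify_mulVec (M.transferMatrix J I * M.transferMatrix I J) 1
  rw [transferMatrix_mul_mulVec_one hI hJ hIJ] at hone
  simp only [Pi.one_apply, Complex.ofReal_one, ← Pi.one_def] at hone
  have hsub : (1 - c) • d • (1 : M.bdry I → ℂ) = 0 := by
    rw [mulVec_smul, hone] at hx
    rw [sub_smul, one_smul, ← hx, sub_self]
  exact hx0 ((smul_eq_zero_iff_right (sub_ne_zero.2 hc1.symm)).1 hsub)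

theorem matSpectrum_transferMatrix_mul_sub_vecMulVec (hI : I ≠ Finset.univ)
    (hJ : J ≠ Finset.univ) (hIJ : I ∪ J = Finset.univ) {q : M.bdry I → ℝ}
    (hq : q ᵥ* (M.transferMatrix J I * M.transferMatrix I J) = q) (hq1 : q ⬝ᵥ 1 = 1) :
    matSpectrum (M.transferMatrix J I * M.transferMatrix I J - vecMulVec 1 q)
      = (matSpectrum (M.transferMatrix J I * M.transferMatrix I J) \ {1}) ∪ {0} := by
  refine matSpectrum_sub_vecMulVec (transferMatrix_mul_mulVec_one hI hJ hIJ) hq hq1 fun x hx => ?_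
  simpa [Pi.one_def] using
    exists_eq_smul_one_of_one_le_norm hI hJ hIJ (c := 1) norm_one.ge (hx.trans (one_smul ℂ x).symm)

end SchwarzCycle

end ClosedTriMesh

section Cover

theorem mem_innerIdx {V : Type*} [Fintype V] {r : ℝ} {h : V → OnePoint ℂ} {i : V} :
    i ∈ innerIdx r h ↔ ∃ z : ℂ, h i = z ∧ ‖z‖ < r := by
  simp [innerIdx]

theorem exists_sphereInversion_eq_coe {r : ℝ} (hr : 1 < r) {p : OnePoint ℂ}
    (hp : ¬ ∃ z : ℂ, p = z ∧ ‖z‖ < r) : ∃ z : ℂ, sphereInversion p = z ∧ ‖z‖ < r := by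
  cases p with
  | infty => exact ⟨0, rfl, by simpa using zero_lt_one.trans hr⟩
  | coe z =>
    have hz : 1 < ‖z‖ := hr.trans_le (not_lt.1 fun hlt => hp ⟨z, rfl, hlt⟩)
    have hz0 : z ≠ 0 := norm_pos_iff.1 (zero_lt_one.trans hz)
    refine ⟨(‖z‖ ^ 2)⁻¹ • z, if_neg hz0, ?_⟩
    have hnorm : ‖(‖z‖ ^ 2)⁻¹ • z‖ = ‖z‖⁻¹ := by
      rw [norm_smul, norm_inv, norm_pow, norm_norm]
      field_simp
    rw [hnorm]
    exact (inv_lt_one_of_one_lt₀ hz).trans hr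

theorem ClosedTriMesh.southIdx_union_northIdx {V : Type*} [Fintype V] [DecidableEq V]
    (M : ClosedTriMesh V) {r : ℝ} (hr : 1 < r)
    (f : V → Metric.sphere (0 : EuclideanSpace ℝ (Fin 3)) 1) :
    southIdx r f ∪ M.northIdx r f = Finset.univ := by
  refine Finset.eq_univ_of_forall fun i => Finset.mem_union.2 (or_iff_not_imp_left.2 fun hi => ?_)
  have hupdate : M.harmonicUpdate (southIdx r f) (fun i => stereoProj (f i)) i = stereoProj (f i) :=
    dif_neg hi
  rw [northIdx, mem_innerIdx, hupdate]
  exact exists_sphereInversion_eq_coe hr fun hz => hi (mem_innerIdx.2 hz)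

end Cover

open Matrix in
theorem mainTheorem2_general {V : Type*} [Fintype V] [DecidableEq V] (M : ClosedTriMesh V)
    {I J : Finset V} (hIJ : I ∪ J = Finset.univ)
    (q₁ : {j // j ∈ M.bdry J} → ℝ) (q₂ : {j // j ∈ M.bdry I} → ℝ)
    (hq : Sum.elim q₁ q₂ ᵥ* fromBlocks 0 (M.transferMatrix I J) (M.transferMatrix J I) 0
      = (1 : ℝ) • Sum.elim q₁ q₂)
    (hq₂ : q₂ ⬝ᵥ 1 = 1) :
    (matSpectrum ((M.transferMatrix J I - vecMulVec 1 q₁) * M.transferMatrix I J)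
        = matSpectrum (M.transferMatrix J I * M.transferMatrix I J - vecMulVec 1 q₂) ∧
      matSpectrum (M.transferMatrix J I * M.transferMatrix I J - vecMulVec 1 q₂)
        = (matSpectrum (M.transferMatrix J I * M.transferMatrix I J) \ {1}) ∪ {0}) ∧
    matSpectralRadius ((M.transferMatrix J I - vecMulVec 1 q₁) * M.transferMatrix I J)
      = matSpectralRadius (M.transferMatrix J I * M.transferMatrix I J - vecMulVec 1 q₂) ∧
    matSpectralRadius (M.transferMatrix J I * M.transferMatrix I J - vecMulVec 1 q₂) < 1 := by
  have ⟨hq₁T, hq₂T⟩ : q₂ ᵥ* M.transferMatrix J I = q₁ ∧ q₁ ᵥ* M.transferMatrix I J = q₂ := by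
    rw [vecMul_fromBlocks, one_smul, Sum.elim_eq_iff] at hq
    simpa using hq
  have hq₂_ne : q₂ ≠ 0 := fun h => by simp [h] at hq₂
  have hq₁_ne : q₁ ≠ 0 := fun h => hq₂_ne (by rw [← hq₂T, h, zero_vecMul])
  have hI : I ≠ Finset.univ := ClosedTriMesh.ne_univ_of_bdry_fun_ne_zero hq₂_ne
  have hJ : J ≠ Finset.univ := ClosedTriMesh.ne_univ_of_bdry_fun_ne_zero hq₁_ne
  have hdeflated : (M.transferMatrix J I - vecMulVec 1 q₁) * M.transferMatrix I J
      = M.transferMatrix J I * M.transferMatrix I J - vecMulVec 1 q₂ := by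
    rw [Matrix.sub_mul, vecMulVec_mul, hq₂T]
  have hspec := ClosedTriMesh.matSpectrum_transferMatrix_mul_sub_vecMulVec hI hJ hIJ
    (by rw [← vecMul_vecMul, hq₁T, hq₂T]) hq₂
  refine ⟨⟨by rw [hdeflated], hspec⟩, by rw [hdeflated], matSpectralRadius_lt_one ?_⟩
  rw [hspec]
  rintro c (⟨hc, hc1⟩ | rfl)
  · exact ClosedTriMesh.norm_lt_one_of_mem_matSpectrum hI hJ hIJ hc hc1
  · exact norm_zero.trans_lt one_pos

theorem mainTheorem2 {V : Type*} [Fintype V] [DecidableEq V]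
    (M : ClosedTriMesh V) (hM : M.IsGenusZero)
    (f : V → Metric.sphere (0 : EuclideanSpace ℝ (Fin 3)) 1)
    (r : ℝ) (hr : 1 < r)
    (hfin : ∀ j ∈ M.southBdry r f, stereoProj (f j) ≠ OnePoint.infty)
    (q₁ : {j // j ∈ M.northBdry r f} → ℝ) (q₂ : {j // j ∈ M.southBdry r f} → ℝ)
    (hq : Matrix.vecMul (Sum.elim q₁ q₂) (M.blockA r f) = (1 : ℝ) • Sum.elim q₁ q₂)
    (hq₂ : q₂ ⬝ᵥ 1 = 1) :
    (matSpectrum ((M.A₂ r f - Matrix.vecMulVec 1 q₁) * M.A₁ r f)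
        = matSpectrum (M.A₂ r f * M.A₁ r f - Matrix.vecMulVec 1 q₂) ∧
      matSpectrum (M.A₂ r f * M.A₁ r f - Matrix.vecMulVec 1 q₂)
        = (matSpectrum (M.A₂ r f * M.A₁ r f) \ {1}) ∪ {0}) ∧
    matSpectralRadius ((M.A₂ r f - Matrix.vecMulVec 1 q₁) * M.A₁ r f)
      = matSpectralRadius (M.A₂ r f * M.A₁ r f - Matrix.vecMulVec 1 q₂) ∧
    matSpectralRadius (M.A₂ r f * M.A₁ r f - Matrix.vecMulVec 1 q₂) < 1 :=
  mainTheorem2_general M (M.southIdx_union_northIdx hr f) q₁ q₂ hq hq₂
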